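/- Let $G$ be a nontrivial topologically ordered locally compact group, that is, a locally compact topological group with a total order such that $s\le t$ implies $rs\le rt$ for all $r,s,t\in G$, and whose topology is the order topology. Fix a left Haar measure on $G$ and let $\delta_G$ be the modular function, $|Es|=\delta_G(s)|E|$. Let $\lambda_s$ ($s\in G$) be the operators $(\lambda_s h)(t)=h(s^{-1}t)$ on $L^2(G)$, let $\mathrm{VN}(G)=\{\lambda_s : s\in G\}''$, and let $\mathcal A\subset \mathrm{VN}(G)$ be the $\sigma$-weakly closed algebra generated by $\{\lambda_s : s\ge e\}$, i.e. the $\sigma$-weak closure of $\mathrm{span}\{\lambda_s : s\ge e\}$. A function $\xi\in L^2(G)$ is left-bounded if $g\mapsto \xi*g$ ($g\in C_c(G)$) extends to a bounded operator $\lambda_\xi$ on $L^2(G)$. The Plancherel weight $\psi$ of $\mathrm{VN}(G)$ satisfies $\psi(x^*x)=\|\xi\|_2^2$ if $x=\lambda_\xi$ with $\xi\in L^2(G)$ left-bounded, and $\psi(x^*x)=\infty$ otherwise. Identify the Haagerup space $L^2(\mathrm{VN}(G))$ with $L^2(G)$ through the standard form (so that $\lambda_\xi h^{1/2}$ corresponds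 to $\xi$, and $h^{1/4}\lambda_\xi h^{1/4}$ to $\delta_G^{1/4}\xi$, $h$ being the density of the dual weight of $\psi$). Let $H^2(\mathcal A)$ be the closed linear span of the products $(h^{1/4}a)(bh^{1/4})$ with $a,b\in\mathcal A$, $\psi(aa^*)<\infty$, $\psi(b^*b)<\infty$; i.e. the closed linear span in $L^2(G)$ of the functions $\delta_G^{1/4}\xi$, where $\xi\in L^2(G)$ is left-bounded and $\lambda_\xi=ab$ for such $a,b$. Let $P_+$ be the orthogonal projection of $L^2(G)$ onto $H^2(\mathcal A)$, and for $f\in\mathrm{VN}(G)$ let $T_f:H^2(\mathcal A)\to H^2(\mathcal A)$, $T_f\xi=P_+(f\xi)$, be the Toeplitz operator with symbol $f$. A bounded operator is upper (lower) semi-Fredholm if its range is closed and its kernel is finite-dimensional (respectively its range is closed and of finite codimension), and Fredholm if it is both. Let $f\in \mathrm{VN}(G)$. If $T_f$ is upper semi-Fredholm, then $f$ is bounded below, i.e. there is $c>0$ with $\|f\xi\|_2\ge c\|\xi\|_2$ for all $\xi\in L^2(G)$. If $T_f$ is Fredholm, then $f$ is invertible in $\mathrm{VN}(G)$. -/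

import Mathlib

open MeasureTheory

namespace GroupHardy

noncomputable section

/-! ### Semi-Fredholm operators -/

section Fredholm

variable {E F : Type*} [NormedAddCommGroup E] [NormedSpace ℂ E]
  [NormedAddCommGroup F] [NormedSpace ℂ F]

/-- Upper semi-Fredholm: closed range and finite-dimensional kernel. -/
def IsUpperSemiFredholm (T : E →L[ℂ] F) : Prop :=
  IsClosed (Set.range T) ∧ FiniteDimensional ℂ (LinearMap.ker (T : E →ₗ[ℂ] F))

/-- Lower semi-Fredholm: closed range of finite codimension. -/
def IsLowerSemiFredholm (T : E →L[ℂ] F) : Prop :=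
  IsClosed (Set.range T) ∧ FiniteDimensional ℂ (F ⧸ LinearMap.range (T : E →ₗ[ℂ] F))

/-- Fredholm: both upper and lower semi-Fredholm. -/
def IsFredholm (T : E →L[ℂ] F) : Prop :=
  IsUpperSemiFredholm T ∧ IsLowerSemiFredholm T

/-- Bounded below: `c * ‖ξ‖ ≤ ‖T ξ‖` for some `c > 0` and all `ξ`. -/
def IsBoundedBelow (T : E →L[ℂ] F) : Prop :=
  ∃ c : ℝ, 0 < c ∧ ∀ ξ : E, c * ‖ξ‖ ≤ ‖T ξ‖

end Fredholm

/-! ### The σ-weak topology -/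

/-- The σ-weak (ultraweak) topology on the bounded operators of a Hilbert space: the initial
topology for the functionals `x ↦ ∑ₙ ⟪ξₙ, x ηₙ⟫` where `(ξₙ)` and `(ηₙ)` are square-summable
sequences of vectors. -/
@[reducible]
def sigmaWeakTopology (H : Type*) [NormedAddCommGroup H] [InnerProductSpace ℂ H] :
    TopologicalSpace (H →L[ℂ] H) :=
  TopologicalSpace.induced
    (fun (x : H →L[ℂ] H) (p : lp (fun _ : ℕ => H) 2 × lp (fun _ : ℕ => H) 2) =>
      ∑' n : ℕ, inner ℂ (p.1 n) (x (p.2 n)))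
    Pi.topologicalSpace

/-! ### The group von Neumann algebra -/

section Group

variable {G : Type*} [Group G] [TopologicalSpace G] [IsTopologicalGroup G]
  [MeasurableSpace G] [BorelSpace G]

/-- The Hilbert space `L²(G)`, with respect to a left Haar measure `μ`. -/
abbrev L2 (μ : Measure G) : Type _ := Lp ℂ 2 μ

/-- The left regular representation: `(λ_s h)(t) = h (s⁻¹ t)`. -/
def lam (μ : Measure G) [μ.IsHaarMeasure] (s : G) : L2 μ →L[ℂ] L2 μ :=
  (Lp.compMeasurePreservingₗᵢ ℂ (fun t : G => s⁻¹ * t)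
    (measurePreserving_mul_left μ s⁻¹)).toContinuousLinearMap

/-- The group von Neumann algebra `VN(G)`: the double commutant of `{λ_s : s ∈ G}`. -/
def VN (μ : Measure G) [μ.IsHaarMeasure] : VonNeumannAlgebra (L2 μ) where
  toStarSubalgebra := StarSubalgebra.centralizer ℂ
    (StarSubalgebra.centralizer ℂ (Set.range (lam μ)) : Set (L2 μ →L[ℂ] L2 μ))
  centralizer_centralizer' := by
    have h := StarSubalgebra.coe_centralizer_centralizer (R := ℂ) (Set.range (lam μ))
    change Set.centralizer (Set.centralizer
      ((StarSubalgebra.centralizer ℂ (StarSubalgebra.centralizer ℂ (Set.range (lam μ)) :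
        Set (L2 μ →L[ℂ] L2 μ)) : StarSubalgebra ℂ (L2 μ →L[ℂ] L2 μ)) :
        Set (L2 μ →L[ℂ] L2 μ))) =
      ((StarSubalgebra.centralizer ℂ (StarSubalgebra.centralizer ℂ (Set.range (lam μ)) :
        Set (L2 μ →L[ℂ] L2 μ)) : StarSubalgebra ℂ (L2 μ →L[ℂ] L2 μ)) :
        Set (L2 μ →L[ℂ] L2 μ))
    rw [h, Set.centralizer_centralizer_centralizer]

/-- The `σ`-weak closure `𝒜` of the span of `{λ_t : t ≥ e}`. -/
def hardyAlgebra [LE G] (μ : Measure G) [μ.IsHaarMeasure] : Set (L2 μ →L[ℂ] L2 μ) :=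
  @closure _ (sigmaWeakTopology (L2 μ))
    (Submodule.span ℂ {x : L2 μ →L[ℂ] L2 μ | ∃ t : G, 1 ≤ t ∧ x = lam μ t} :
      Set (L2 μ →L[ℂ] L2 μ))

/-! ### The Plancherel weight and `L²(VN(G))`

The GNS Hilbert space of the Plancherel weight `ψ` of `VN(G)` is `L²(G)`: one has
`ψ(x* x) = ‖ξ‖₂²` if `x = λ_ξ` for a left-bounded `ξ ∈ L²(G)`, and `ψ(x* x) = ∞` otherwise, and the
GNS map is `λ_ξ ↦ ξ`. -/

/-- The convolution `(ξ * g)(t) = ∫ ξ(s) g(s⁻¹ t) ds`. -/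
def conv (μ : Measure G) (ξ g : G → ℂ) (t : G) : ℂ := ∫ s, ξ s * g (s⁻¹ * t) ∂μ

/-- `ξ ∈ L²(G)` is left-bounded and `x = λ_ξ`, i.e. `x` is the (unique) bounded operator on `L²(G)`
that extends `g ↦ ξ * g`, `g ∈ C_c(G)`. -/
def IsLeftConvolution (μ : Measure G) [μ.IsHaarMeasure] (ξ : L2 μ) (x : L2 μ →L[ℂ] L2 μ) :
    Prop :=
  ∀ (g : G → ℂ) (hg : Continuous g) (hs : HasCompactSupport g),
    x ((hg.memLp_of_hasCompactSupport hs : MemLp g 2 μ).toLp g) =ᵐ[μ] conv μ ξ g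

/-- `ψ(x* x) < ∞` for the Plancherel weight `ψ`. -/
def IsSquareIntegrable (μ : Measure G) [μ.IsHaarMeasure] (x : L2 μ →L[ℂ] L2 μ) : Prop :=
  ∃ ξ : L2 μ, IsLeftConvolution μ ξ x

variable [LocallyCompactSpace G]

/-- The modular function `δ_G` of `G`, normalised by `μ(E s) = δ_G(s) μ(E)` for left Haar
measures `μ`. (Mathlib's `modularCharacter s` is the factor for `E s⁻¹`.) -/
def modularFn (s : G) : ℝ := (Measure.modularCharacter s⁻¹ : NNReal)

/-- `η` is the image in `L²(G)` of `h^{1/4} x h^{1/4} ∈ L²(VN(G))`. Here `L²(VN(G))` is the Haagerup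
`L²`-space, `h` is the density of the dual weight of `ψ`, and `L²(VN(G))` is identified with `L²(G)`
by the standard form isomorphism, which sends `λ_ξ h^{1/2}` to `ξ`. Since the modular automorphisms
are `λ_s ↦ h^{it} λ_s h^{-it} = δ_G(s)^{it} λ_s`, one has
`h^{1/4} λ_ξ h^{1/4} = λ_{δ_G^{1/4} ξ} h^{1/2}`, so that the image of `h^{1/4} λ_ξ h^{1/4}` is
the function `δ_G^{1/4} ξ`. -/
def IsSymmetricEmbedding (μ : Measure G) [μ.IsHaarMeasure] (x : L2 μ →L[ℂ] L2 μ) (η : L2 μ) :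
    Prop :=
  ∃ ξ : L2 μ, IsLeftConvolution μ ξ x ∧
    η =ᵐ[μ] fun s => ((modularFn s ^ (1 / 4 : ℝ) : ℝ) : ℂ) * ξ s

/-- The Hardy space `H²(𝒜) ⊆ L²(VN(G)) ≅ L²(G)`: the closed linear span of the products
`(h^{1/4} a) (b h^{1/4})` with `a, b ∈ 𝒜`, `ψ(a a*) < ∞` and `ψ(b* b) < ∞`. -/
def H2 [LE G] (μ : Measure G) [μ.IsHaarMeasure] : Submodule ℂ (L2 μ) :=
  (Submodule.span ℂ {η : L2 μ | ∃ a ∈ hardyAlgebra μ, ∃ b ∈ hardyAlgebra μ,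
    IsSquareIntegrable μ (star a) ∧ IsSquareIntegrable μ b ∧
      IsSymmetricEmbedding μ (a * b) η}).topologicalClosure

instance [LE G] (μ : Measure G) [μ.IsHaarMeasure] : CompleteSpace (H2 μ) := by
  unfold H2
  infer_instance

/-- The Toeplitz operator `T_f : H² → H²`, `T_f ξ = P₊ (f ξ)`, where `P₊` is the orthogonal
projection of `L²(G)` onto `H²`. -/
def toeplitz [LE G] (μ : Measure G) [μ.IsHaarMeasure] (f : L2 μ →L[ℂ] L2 μ) :
    H2 μ →L[ℂ] H2 μ :=
  (H2 μ).orthogonalProjectionOnto ∘L f ∘L (H2 μ).subtypeL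

end Group

end

end GroupHardy

/-!
The right translations `ρ_t` of `L²(G)` commute with `VN(G)`. If `t` tends to infinity in the
order of `G`, then `ρ_t` tends weakly to zero, as the right translates of a compact set leave every
compact set, and `ρ_t` moves every vector asymptotically into `H²(𝒜)`. Hence, for `ξ ∈ L²(G)`, the
projections `x_t = P₊ ρ_t ξ` satisfy `‖x_t‖ → ‖ξ‖`, tend weakly to zero, and
`limsup ‖T_f x_t‖ ≤ lim ‖f ρ_t ξ‖ = lim ‖ρ_t f ξ‖ = ‖f ξ‖`. An upper semi-Fredholm operator `T_f` is
bounded below modulo its finite-dimensional kernel, and the component of `x_t` in the kernel tends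
to zero in norm. It follows that `c ‖ξ‖ ≤ ‖f ξ‖` (`isBoundedBelow_of_compression_estimate`).

If `T_f` is Fredholm, then `T_f^* = T_{f^*}` also is bounded below modulo a finite-dimensional space,
so that both `f` and `f^*` are bounded below, and `f` is invertible; its inverse is in the double
commutant.

That `ρ_t` moves vectors into `H²(𝒜)` only needs a lower bound for `H²(𝒜)`: it contains `h * g` for
all `h, g ∈ C_c(G)` supported in `{s | 1 ≤ s}` (`convOp_toL2_mem_H2_of_one_le`). Indeed `δ^{1/4}` is a
character, so that `h * g` is `δ^{1/4}` times a convolution of two functions of the same kind, and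
`λ_h = ∫ h(s) λ_s ds` is in the `σ`-weak closure of the span of `{λ_s | 1 ≤ s}`. As
`ρ_t (h * g) = h * ρ_t g`, and as the support of `ρ_t g` eventually is in `{s | 1 ≤ s}` for any
`g ∈ C_c(G)`, only `h` has to be supported there, and such convolutions are dense in `L²(G)`
(`dense_eventuallyHardy`).
-/

open MeasureTheory Filter Topology
open scoped CompactlySupported Pointwise

namespace GroupHardy

noncomputable section

/-! ### Compressions of operators commuting with asymptotic translations -/

section Hilbert

variable {H : Type*} [NormedAddCommGroup H] [InnerProductSpace ℂ H]

theorem norm_sub_starProjection_le (K : Submodule ℂ H) [K.HasOrthogonalProjection] (x : H) {y : H}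
    (hy : y ∈ K) : ‖x - K.starProjection x‖ ≤ ‖x - y‖ := by
  rw [Submodule.starProjection_minimal]
  refine ciInf_le ⟨0, ?_⟩ (⟨y, hy⟩ : K)
  rintro _ ⟨z, rfl⟩
  exact norm_nonneg _

/-- Let `f` commute with isometries `R i` that move every vector asymptotically into `M` and tend
weakly to zero. If the compression of `f` to `M` is bounded below modulo a finite-dimensional
subspace, then `f` is bounded below: the component of `R i ξ` in the finite-dimensional subspace
disappears in the limit. -/
theorem isBoundedBelow_of_compression_estimate [CompleteSpace H] (M : Submodule ℂ H)
    [M.HasOrthogonalProjection]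
    (f : H →L[ℂ] H) {ι : Type*} (l : Filter ι) [l.NeBot] (R : ι → H →ₗᵢ[ℂ] H)
    (hcomm : ∀ i x, f (R i x) = R i (f x))
    (hM : ∀ x, Tendsto (fun i => R i x - M.starProjection (R i x)) l (𝓝 0))
    (hweak : ∀ x u, Tendsto (fun i => inner ℂ u (R i x)) l (𝓝 0))
    (K : Submodule ℂ M) [FiniteDimensional ℂ K] (C : ℝ) (hC : 0 < C)
    (hK : ∀ x : M, ‖x - K.starProjection x‖ ≤
      C * ‖(M.orthogonalProjectionOnto ∘L f ∘L M.subtypeL) x‖) :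
    IsBoundedBelow f := by
  refine ⟨C⁻¹, inv_pos.2 hC, fun ξ => ?_⟩
  rw [inv_mul_le_iff₀ hC]
  let x : ι → M := fun i => M.orthogonalProjectionOnto (R i ξ)
  have hx : ∀ i, ((x i : M) : H) = M.starProjection (R i ξ) := fun i => rfl
  have hQ : Tendsto (fun i => K.starProjection (x i)) l (𝓝 0) := by
    let b := stdOrthonormalBasis ℂ K
    have h : ∀ i, K.starProjection (x i) =
        ∑ j, (inner ℂ (((b j : K) : M) : H) (R i ξ)) • ((b j : K) : M) := by
      intro i
      rw [Submodule.starProjection_apply, b.orthogonalProjectionOnto_apply_eq_sum]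
      simp only [Submodule.coe_sum, Submodule.coe_smul]
      refine Finset.sum_congr rfl fun j _ => ?_
      congr 1
      exact Submodule.inner_orthogonalProjectionOnto_eq_of_mem_left _ _
    simp_rw [h]
    rw [← Finset.sum_const_zero (ι := Fin (Module.finrank ℂ K)) (s := Finset.univ)]
    refine tendsto_finsetSum _ fun j _ => ?_
    simpa using (hweak ξ (((b j : K) : M) : H)).smul_const ((b j : K) : M)
  -- `f x_i` differs from `f R_i ξ = R_i f ξ` by `f (R_i ξ - x_i)`, which tends to zero
  have hle : ∀ i, ‖ξ‖ ≤ C * (‖f ξ‖ + ‖f‖ * ‖R i ξ - M.starProjection (R i ξ)‖) +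
      ‖K.starProjection (x i)‖ + ‖R i ξ - M.starProjection (R i ξ)‖ := by
    intro i
    have h1 : ‖ξ‖ ≤ ‖x i‖ + ‖R i ξ - M.starProjection (R i ξ)‖ := by
      rw [← (R i).norm_map ξ, ← Submodule.norm_coe, hx]
      have := norm_add_le (M.starProjection (R i ξ)) (R i ξ - M.starProjection (R i ξ))
      rwa [add_sub_cancel] at this
    have h2 : ‖x i‖ ≤ ‖x i - K.starProjection (x i)‖ + ‖K.starProjection (x i)‖ := by
      simpa using norm_add_le (x i - K.starProjection (x i)) (K.starProjection (x i))
    have h3 : ‖(M.orthogonalProjectionOnto ∘L f ∘L M.subtypeL) (x i)‖ ≤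
        ‖f ξ‖ + ‖f‖ * ‖R i ξ - M.starProjection (R i ξ)‖ := by
      have e : f (x i) = R i (f ξ) - f (R i ξ - M.starProjection (R i ξ)) := by
        rw [map_sub, hcomm, hx]; abel
      calc _ ≤ ‖f (x i)‖ := M.norm_orthogonalProjectionOnto_apply_le _
        _ ≤ ‖R i (f ξ)‖ + ‖f (R i ξ - M.starProjection (R i ξ))‖ := by
          rw [e]; exact norm_sub_le _ _
        _ ≤ _ := by rw [(R i).norm_map]; gcongr; exact f.le_opNorm _
    have h4 := (hK (x i)).trans (mul_le_mul_of_nonneg_left h3 hC.le)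
    linarith
  have hlim : Tendsto (fun i => C * (‖f ξ‖ + ‖f‖ * ‖R i ξ - M.starProjection (R i ξ)‖) +
      ‖K.starProjection (x i)‖ + ‖R i ξ - M.starProjection (R i ξ)‖) l
      (𝓝 (C * (‖f ξ‖ + ‖f‖ * 0) + 0 + 0)) := by
    have a := (hM ξ).norm
    have b := hQ.norm
    rw [norm_zero] at a b
    exact ((((a.const_mul _).const_add _).const_mul _).add b).add a
  simpa using ge_of_tendsto' hlim hle

/-- The open mapping theorem for `T` as a map onto its range. -/
theorem exists_preimage_norm_le_of_isClosed_range {E F : Type*} [NormedAddCommGroup E]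
    [NormedSpace ℂ E] [CompleteSpace E] [NormedAddCommGroup F] [NormedSpace ℂ F] [CompleteSpace F]
    (T : E →L[ℂ] F) (hT : IsClosed (Set.range T)) :
    ∃ C > 0, ∀ x, ∃ z, T z = T x ∧ ‖z‖ ≤ C * ‖T x‖ := by
  have hcl : IsClosed ((LinearMap.range (T : E →ₗ[ℂ] F) : Submodule ℂ F) : Set F) := hT
  have : CompleteSpace (LinearMap.range (T : E →ₗ[ℂ] F)) := hcl.completeSpace_coe
  let T' : E →L[ℂ] LinearMap.range (T : E →ₗ[ℂ] F) := T.codRestrict _ fun x => ⟨x, rfl⟩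
  have hs : Function.Surjective T' := by
    rintro ⟨_, x, rfl⟩; exact ⟨x, rfl⟩
  obtain ⟨C, hC, h⟩ := T'.exists_preimage_norm_le hs
  refine ⟨C, hC, fun x => ?_⟩
  obtain ⟨z, hz, hz'⟩ := h (T' x)
  exact ⟨z, congrArg Subtype.val hz, hz'⟩

/-- An upper semi-Fredholm operator is bounded below on the orthogonal complement of its kernel. -/
theorem IsUpperSemiFredholm.exists_norm_sub_le {E : Type*} [NormedAddCommGroup E]
    [InnerProductSpace ℂ E] [CompleteSpace E] (T : E →L[ℂ] E) (hT : IsUpperSemiFredholm T) :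
    ∃ K : Submodule ℂ E, ∃ _ : FiniteDimensional ℂ K, ∃ C > 0,
      ∀ x, ‖x - K.starProjection x‖ ≤ C * ‖T x‖ := by
  obtain ⟨hcl, hfin⟩ := hT
  obtain ⟨C, hC, h⟩ := exists_preimage_norm_le_of_isClosed_range T hcl
  refine ⟨LinearMap.ker (T : E →ₗ[ℂ] E), hfin, C, hC, fun x => ?_⟩
  obtain ⟨z, hz, hz'⟩ := h x
  refine le_trans ?_ hz'
  have hmem : x - z ∈ LinearMap.ker (T : E →ₗ[ℂ] E) := by simp [hz]
  exact (norm_sub_starProjection_le _ x hmem).trans_eq (by rw [sub_sub_cancel])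

/-- The adjoint `S` of a lower semi-Fredholm operator `T` is bounded below on the range of `T`, which
is the orthogonal complement of a finite-dimensional subspace. -/
theorem IsLowerSemiFredholm.exists_norm_sub_le_adjoint {E : Type*} [NormedAddCommGroup E]
    [InnerProductSpace ℂ E] [CompleteSpace E] (T S : E →L[ℂ] E) (hT : IsLowerSemiFredholm T)
    (hS : ∀ x y, inner ℂ (T x) y = inner ℂ x (S y)) :
    ∃ K : Submodule ℂ E, ∃ _ : FiniteDimensional ℂ K, ∃ C > 0,
      ∀ x, ‖x - K.starProjection x‖ ≤ C * ‖S x‖ := by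
  obtain ⟨hcl, hfin⟩ := hT
  obtain ⟨C, hC, h⟩ := exists_preimage_norm_le_of_isClosed_range T hcl
  set V := LinearMap.range (T : E →ₗ[ℂ] E) with hV
  have hVcl : IsClosed (V : Set E) := hcl
  have : CompleteSpace V := hVcl.completeSpace_coe
  have : FiniteDimensional ℂ Vᗮ :=
    (Submodule.quotientEquivOfIsCompl V Vᗮ V.isCompl_orthogonal).finiteDimensional
  refine ⟨Vᗮ, inferInstance, C, hC, fun x => ?_⟩
  have hy : x - Vᗮ.starProjection x = V.starProjection x := by
    rw [Submodule.starProjection_orthogonal_val]; abel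
  rw [hy]
  obtain ⟨z₀, hz₀⟩ : V.starProjection x ∈ V := V.starProjection_apply_mem x
  obtain ⟨z, hz, hzn⟩ := h z₀
  have hz₀' : T z₀ = V.starProjection x := hz₀
  rw [hz₀'] at hz hzn
  set y := V.starProjection x
  have hinner : inner ℂ y y = inner ℂ z (S x) := by
    rw [← hS, hz]
    have := V.starProjection_inner_eq_zero x y (V.starProjection_apply_mem x)
    rw [inner_sub_left, sub_eq_zero] at this
    rw [← inner_conj_symm y x, this, inner_conj_symm]
  have h2 : ‖y‖ * ‖y‖ ≤ (C * ‖S x‖) * ‖y‖ := by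
    calc ‖y‖ * ‖y‖ = ‖inner ℂ y y‖ := by
          rw [inner_self_eq_norm_sq_to_K, norm_pow, ← pow_two]; simp
      _ ≤ ‖z‖ * ‖S x‖ := by rw [hinner]; exact norm_inner_le_norm _ _
      _ ≤ (C * ‖y‖) * ‖S x‖ := by gcongr
      _ = _ := by ring
  rcases (norm_nonneg y).eq_or_lt with h0 | h0
  · rw [← h0]; positivity
  · exact le_of_mul_le_mul_right h2 h0

theorem IsBoundedBelow.isUnit [CompleteSpace H] (f : H →L[ℂ] H) (hf : IsBoundedBelow f)
    (hf' : IsBoundedBelow (star f)) : IsUnit f := by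
  obtain ⟨c, hc, hfc⟩ := hf
  obtain ⟨d, hd, hfd⟩ := hf'
  rw [ContinuousLinearMap.isUnit_iff_bijective,
    ContinuousLinearMap.bijective_iff_dense_range_and_antilipschitz]
  refine ⟨?_, c.toNNReal⁻¹, AddMonoidHomClass.antilipschitz_of_bound f fun x => ?_⟩
  · rw [Submodule.topologicalClosure_eq_top_iff, Submodule.eq_bot_iff]
    intro x hx
    have h0 : star f x = 0 := by
      rw [← inner_self_eq_zero (𝕜 := ℂ), ContinuousLinearMap.star_eq_adjoint,
        ContinuousLinearMap.adjoint_inner_left, ← inner_conj_symm]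
      have := (Submodule.mem_orthogonal _ _).1 hx (f (f.adjoint x)) ⟨_, rfl⟩
      rw [this, map_zero]
    have := hfd x
    rw [h0, norm_zero] at this
    exact norm_le_zero_iff.1 (by nlinarith)
  · have := hfc x
    rw [NNReal.coe_inv, Real.coe_toNNReal _ hc.le, inv_mul_eq_div, le_div_iff₀ hc]
    linarith

theorem isUnit_vonNeumannAlgebra [CompleteSpace H] (A : VonNeumannAlgebra H) (f : A)
    (hf : IsUnit (f : H →L[ℂ] H)) : IsUnit f := by
  obtain ⟨u, hu⟩ := hf
  have hmem : ((u⁻¹ : (H →L[ℂ] H)ˣ) : H →L[ℂ] H) ∈ A := by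
    rw [← SetLike.mem_coe, ← VonNeumannAlgebra.centralizer_centralizer]
    intro y hy
    have hc : (u : H →L[ℂ] H) * y = y * u := by
      rw [hu]; exact (hy f f.2)
    rw [Units.mul_inv_eq_iff_eq_mul, mul_assoc, ← hc, Units.inv_mul_cancel_left]
  refine ⟨⟨f, ⟨_, hmem⟩, ?_, ?_⟩, rfl⟩
  · ext1; change (f : H →L[ℂ] H) * _ = 1; rw [← hu]; simp
  · ext1; change _ * (f : H →L[ℂ] H) = 1; rw [← hu]; simp

end Hilbert

/-! ### Compactly supported functions and the left regular representation -/

section Regular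

variable {G : Type*} [Group G] [TopologicalSpace G] [IsTopologicalGroup G]

/-- The left translate `x ↦ k (s⁻¹ x)`. -/
def leftTranslate (s : G) (k : C_c(G, ℂ)) : C_c(G, ℂ) where
  toFun x := k (s⁻¹ * x)
  continuous_toFun := k.continuous.comp (continuous_const_mul _)
  hasCompactSupport' := k.hasCompactSupport.comp_homeomorph (Homeomorph.mulLeft s⁻¹)

/-- The right translate `x ↦ k (x t⁻¹)`. -/
def rightTranslate (t : G) (k : C_c(G, ℂ)) : C_c(G, ℂ) where
  toFun x := k (x * t⁻¹)
  continuous_toFun := k.continuous.comp (continuous_mul_const _)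
  hasCompactSupport' := k.hasCompactSupport.comp_homeomorph (Homeomorph.mulRight t⁻¹)

/-- The pointwise product of a continuous function with a compactly supported one. -/
def pointwiseMul (w : C(G, ℂ)) (k : C_c(G, ℂ)) : C_c(G, ℂ) where
  toFun x := w x * k x
  continuous_toFun := w.continuous.mul k.continuous
  hasCompactSupport' := k.hasCompactSupport.mul_left

variable [MeasurableSpace G] [BorelSpace G] (μ : Measure G) [μ.IsHaarMeasure]

/-- The convolution of two continuous compactly supported functions. -/
def convCc (h g : C_c(G, ℂ)) : C_c(G, ℂ) where
  toFun := conv μ h g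
  continuous_toFun := by
    rw [← continuousOn_univ]
    refine continuousOn_integral_of_compact_support h.hasCompactSupport ?_ ?_
    · exact ((h.continuous.comp continuous_snd).mul
        (g.continuous.comp (continuous_snd.inv.mul continuous_fst))).continuousOn
    · intro x s _ hs
      simp [image_eq_zero_of_notMem_tsupport hs]
  hasCompactSupport' := by
    refine HasCompactSupport.intro (h.hasCompactSupport.isCompact.mul
      g.hasCompactSupport.isCompact) fun x hx => ?_
    refine integral_eq_zero_of_ae (Eventually.of_forall fun s => ?_)
    by_contra hne
    have hne' := mul_ne_zero_iff.1 hne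
    exact hx ⟨s, subset_tsupport _ hne'.1, s⁻¹ * x, subset_tsupport _ hne'.2, by simp⟩

theorem convCc_apply (h g : C_c(G, ℂ)) (x : G) :
    convCc μ h g x = ∫ s, h s * g (s⁻¹ * x) ∂μ := rfl

theorem convCc_assoc (h g k : C_c(G, ℂ)) :
    convCc μ h (convCc μ g k) = convCc μ (convCc μ h g) k := by
  ext x
  simp only [convCc_apply]
  have hleft : ∀ s, h s * ∫ r, g r * k (r⁻¹ * (s⁻¹ * x)) ∂μ =
      ∫ r, h s * g (s⁻¹ * r) * k (r⁻¹ * x) ∂μ := by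
    intro s
    rw [← integral_const_mul, ← integral_mul_left_eq_self _ s⁻¹]
    refine integral_congr_ae (Eventually.of_forall fun r => ?_)
    simp [mul_assoc]
  have hright : ∀ r, (∫ s, h s * g (s⁻¹ * r) ∂μ) * k (r⁻¹ * x) =
      ∫ s, h s * g (s⁻¹ * r) * k (r⁻¹ * x) ∂μ := fun r => (integral_mul_const _ _).symm
  simp_rw [hleft, hright]
  refine integral_integral_swap_of_hasCompactSupport ?_ ?_
  · have := h.continuous
    have := g.continuous
    have := k.continuous
    unfold Function.uncurry
    fun_prop
  · refine HasCompactSupport.intro (h.hasCompactSupport.isCompact.prod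
      (h.hasCompactSupport.isCompact.mul g.hasCompactSupport.isCompact)) ?_
    rintro ⟨s, r⟩ hsr
    by_contra hne
    have hne' := mul_ne_zero_iff.1 (mul_ne_zero_iff.1 hne).1
    exact hsr ⟨subset_tsupport _ hne'.1,
      ⟨s, subset_tsupport _ hne'.1, s⁻¹ * r, subset_tsupport _ hne'.2, by simp⟩⟩

/-- The class in `L²(G)` of a continuous compactly supported function. -/
def toL2 (k : C_c(G, ℂ)) : L2 μ :=
  (k.continuous.memLp_of_hasCompactSupport k.hasCompactSupport : MemLp k 2 μ).toLp k

omit [IsTopologicalGroup G] in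
theorem coeFn_toL2 (k : C_c(G, ℂ)) : toL2 μ k =ᵐ[μ] k := MemLp.coeFn_toLp _

omit [IsTopologicalGroup G] in
theorem eq_toL2_of_ae {x : L2 μ} {k : C_c(G, ℂ)} (h : x =ᵐ[μ] k) : x = toL2 μ k :=
  Lp.ext (h.trans (coeFn_toL2 μ k).symm)

omit [IsTopologicalGroup G] in
theorem toL2_smul (c : ℂ) (k : C_c(G, ℂ)) : toL2 μ (c • k) = c • toL2 μ k := by
  symm
  refine eq_toL2_of_ae μ ?_
  filter_upwards [Lp.coeFn_smul c (toL2 μ k), coeFn_toL2 μ k] with x h1 h2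
  simp [h1, h2]

omit [IsTopologicalGroup G] in
theorem inner_toL2 (u k : C_c(G, ℂ)) :
    inner ℂ (toL2 μ u) (toL2 μ k) = ∫ x, k x * starRingEnd ℂ (u x) ∂μ := by
  rw [L2.inner_def]
  refine integral_congr_ae ?_
  filter_upwards [coeFn_toL2 μ u, coeFn_toL2 μ k] with x h1 h2
  simp [h1, h2, RCLike.inner_apply]

theorem denseRange_toL2 [NormalSpace G] [LocallyCompactSpace G] [μ.Regular] :
    DenseRange (toL2 μ) := by
  intro x
  rw [EMetric.mem_closure_iff]
  intro ε hε
  obtain ⟨δ, hδ, hδε⟩ := exists_between hε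
  obtain ⟨g, hgs, hg, hgc, hgm⟩ := (Lp.memLp x).exists_hasCompactSupport_eLpNorm_sub_le
    (by simp) hδ.ne'
  refine ⟨_, ⟨⟨⟨g, hgc⟩, hgs⟩, rfl⟩, lt_of_le_of_lt ?_ hδε⟩
  rw [Lp.edist_def]
  refine (eLpNorm_congr_ae ?_).trans_le hg
  filter_upwards [coeFn_toL2 μ ⟨⟨g, hgc⟩, hgs⟩] with y hy
  simp [hy]

theorem coeFn_lam (s : G) (x : L2 μ) : lam μ s x =ᵐ[μ] fun t => x (s⁻¹ * t) :=
  Lp.coeFn_compMeasurePreserving x (measurePreserving_mul_left μ s⁻¹)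

theorem norm_lam_apply (s : G) (x : L2 μ) : ‖lam μ s x‖ = ‖x‖ :=
  (Lp.compMeasurePreservingₗᵢ ℂ (fun t : G => s⁻¹ * t)
    (measurePreserving_mul_left μ s⁻¹)).norm_map x

theorem lam_toL2 (s : G) (k : C_c(G, ℂ)) : lam μ s (toL2 μ k) = toL2 μ (leftTranslate s k) := by
  refine eq_toL2_of_ae μ ((coeFn_lam μ s _).trans ?_)
  exact (measurePreserving_mul_left μ s⁻¹).quasiMeasurePreserving.ae_eq_comp (coeFn_toL2 μ k)

theorem lam_lam (s r : G) (x : L2 μ) : lam μ s (lam μ r x) = lam μ (s * r) x := by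
  refine Lp.ext ?_
  have h := (measurePreserving_mul_left μ s⁻¹).quasiMeasurePreserving.ae_eq_comp (coeFn_lam μ r x)
  filter_upwards [coeFn_lam μ s (lam μ r x), coeFn_lam μ (s * r) x, h] with t h1 h2 h3
  simp only [Function.comp_apply] at h3
  rw [h1, h2, h3, mul_inv_rev, mul_assoc]

theorem lam_one (x : L2 μ) : lam μ 1 x = x := by
  refine Lp.ext ?_
  filter_upwards [coeFn_lam μ 1 x] with t h
  simp [h]

theorem inner_lam_right (s : G) (x y : L2 μ) :
    inner ℂ x (lam μ s y) = inner ℂ (lam μ s⁻¹ x) y := by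
  conv_lhs => rw [← lam_one μ x, ← mul_inv_cancel s, ← lam_lam]
  exact (Lp.compMeasurePreservingₗᵢ ℂ (fun t : G => s⁻¹ * t)
    (measurePreserving_mul_left μ s⁻¹)).inner_map_map (lam μ s⁻¹ x) y

theorem star_lam (s : G) : star (lam μ s) = lam μ s⁻¹ := by
  rw [ContinuousLinearMap.star_eq_adjoint]
  symm
  rw [ContinuousLinearMap.eq_adjoint_iff]
  intro x y
  rw [inner_lam_right]

theorem continuous_lam_apply [LocallyCompactSpace G] [μ.Regular] (x : L2 μ) :
    Continuous fun s => lam μ s x := by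
  let g : C(G, C(G, G)) :=
    (ContinuousMap.mk (fun p : G × G => p.1⁻¹ * p.2) (by fun_prop)).curry
  exact (continuous_const (y := x)).compMeasurePreservingLp g.continuous
    (fun s => measurePreserving_mul_left μ s⁻¹) (by simp)

theorem isLeftConvolution_of_toL2 (h : C_c(G, ℂ)) (x : L2 μ →L[ℂ] L2 μ)
    (hx : ∀ g : C_c(G, ℂ), x (toL2 μ g) = toL2 μ (convCc μ h g)) :
    IsLeftConvolution μ (toL2 μ h) x := by
  intro g hg hs
  change x (toL2 μ ⟨⟨g, hg⟩, hs⟩) =ᵐ[μ] _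
  rw [hx]
  refine (coeFn_toL2 μ _).trans (Eventually.of_forall fun t => ?_)
  refine integral_congr_ae ?_
  filter_upwards [coeFn_toL2 μ h] with s hs
  rw [hs]
  rfl

end Regular

/-! ### Convolution operators -/

section ConvOp

variable {G : Type*} [Group G] [TopologicalSpace G] [IsTopologicalGroup G]
  [MeasurableSpace G] [BorelSpace G] [LocallyCompactSpace G]
  (μ : Measure G) [μ.IsHaarMeasure] [μ.Regular]

theorem integrable_smul_lam (h : C_c(G, ℂ)) (x : L2 μ) :
    Integrable (fun s => h s • lam μ s x) μ :=
  (h.continuous.smul (continuous_lam_apply μ x)).integrable_of_hasCompactSupport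
    h.hasCompactSupport.smul_right

/-- The operator `λ_h = ∫ h(s) λ_s ds`, for `h` continuous with compact support; the integral
converges strongly. -/
def convOp (h : C_c(G, ℂ)) : L2 μ →L[ℂ] L2 μ :=
  LinearMap.mkContinuous
    { toFun := fun x => ∫ s, h s • lam μ s x ∂μ
      map_add' := fun x y => by
        simp only [map_add, smul_add]
        exact integral_add (integrable_smul_lam μ h x) (integrable_smul_lam μ h y)
      map_smul' := fun c x => by
        simp only [map_smul, RingHom.id_apply]
        rw [← integral_smul]
        simp only [smul_comm c] }
    (∫ s, ‖h s‖ ∂μ) fun x => by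
      refine (norm_integral_le_integral_norm _).trans_eq ?_
      simp only [norm_smul, norm_lam_apply]
      exact integral_mul_const _ _

theorem convOp_apply (h : C_c(G, ℂ)) (x : L2 μ) :
    convOp μ h x = ∫ s, h s • lam μ s x ∂μ := rfl

theorem inner_convOp (h : C_c(G, ℂ)) (x y : L2 μ) :
    inner ℂ x (convOp μ h y) = ∫ s, h s * inner ℂ x (lam μ s y) ∂μ := by
  rw [convOp_apply, ← integral_inner (integrable_smul_lam μ h y)]
  simp only [inner_smul_right]

/-- Both sides are compared after pairing with `u ∈ C_c(G)`, since `G` need not be `σ`-compact and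
Fubini's theorem is only available for continuous functions with compact support. -/
theorem convOp_toL2 [NormalSpace G] (h g : C_c(G, ℂ)) :
    convOp μ h (toL2 μ g) = toL2 μ (convCc μ h g) := by
  refine (denseRange_toL2 μ).eq_of_inner_right (𝕜 := ℂ) ?_
  intro u
  rw [inner_convOp, inner_toL2]
  simp only [lam_toL2, inner_toL2, convCc_apply]
  simp_rw [← integral_const_mul, ← integral_mul_const, ← mul_assoc]
  refine integral_integral_swap_of_hasCompactSupport ?_ ?_
  · have := h.continuous
    have := g.continuous
    have := u.continuous
    have := RCLike.continuous_conj (K := ℂ)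
    unfold Function.uncurry leftTranslate
    change Continuous fun p : G × G => h p.1 * g (p.1⁻¹ * p.2) * starRingEnd ℂ (u p.2)
    fun_prop
  · refine HasCompactSupport.intro (h.hasCompactSupport.isCompact.prod
      u.hasCompactSupport.isCompact) ?_
    rintro ⟨s, r⟩ hsr
    by_contra hne
    have hne' := mul_ne_zero_iff.1 hne
    exact hsr ⟨subset_tsupport _ (mul_ne_zero_iff.1 hne'.1).1,
      subset_tsupport _ fun h0 => hne'.2 (by simp [h0])⟩

theorem isLeftConvolution_convOp [NormalSpace G] (h : C_c(G, ℂ)) :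
    IsLeftConvolution μ (toL2 μ h) (convOp μ h) :=
  isLeftConvolution_of_toL2 μ h _ (convOp_toL2 μ h)

theorem isLeftConvolution_convOp_mul [NormalSpace G] (h g : C_c(G, ℂ)) :
    IsLeftConvolution μ (toL2 μ (convCc μ h g)) (convOp μ h * convOp μ g) :=
  isLeftConvolution_of_toL2 μ _ _ fun k => by
    rw [mul_apply_eq_comp, convOp_toL2, convOp_toL2, convCc_assoc]

end ConvOp

/-! ### The modular function -/

section Modular

variable {G : Type*} [Group G] [TopologicalSpace G] [IsTopologicalGroup G]
  [LocallyCompactSpace G]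

theorem modularCharacter_pos (g : G) : 0 < Measure.modularCharacter g :=
  Measure.modularCharacterFun_pos g

section Measure

variable [MeasurableSpace G] [BorelSpace G] (μ : Measure G) [μ.IsHaarMeasure] [μ.Regular]

theorem map_mul_right_eq_modularCharacter_smul (g : G) :
    μ.map (· * g) = Measure.modularCharacter g • μ := by
  have : (μ.map (· * g)).Regular := Measure.Regular.map (Homeomorph.mulRight g)
  change _ = Measure.modularCharacterFun g • μ
  rw [Measure.modularCharacterFun_eq_haarScalarFactor μ g]
  exact Measure.isMulLeftInvariant_eq_smul_of_regular _ μ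

theorem integral_mul_right_eq_modularCharacter_mul (f : G → ℝ) (g : G) :
    ∫ x, f (x * g) ∂μ = Measure.modularCharacter g * ∫ x, f x ∂μ := by
  have h := (Homeomorph.mulRight g).measurableEmbedding.integral_map (μ := μ) f
  simp only [Homeomorph.coe_mulRight] at h
  rw [← h, map_mul_right_eq_modularCharacter_smul, integral_smul_nnreal_measure]
  rfl

end Measure

/-- For fixed `f ∈ C_c(G)`, the integral `∫ f(x g) dx` is continuous in `g`, and it is the modular
character of `g` times a constant. -/
theorem continuous_modularCharacter : Continuous (Measure.modularCharacter : G → NNReal) := by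
  borelize G
  let μ : Measure G := Measure.haar
  obtain ⟨⟨f, hf⟩, hs, h0, h1⟩ :
    ∃ f : C(G, ℝ), HasCompactSupport f ∧ 0 ≤ f ∧ f 1 ≠ 0 := exists_continuous_nonneg_pos 1
  have hpos : 0 < ∫ x, f x ∂μ :=
    hf.integral_pos_of_hasCompactSupport_nonneg_nonzero hs h0 h1
  have hcont : Continuous fun g => ∫ x, f (x * g) ∂μ := by
    refine continuous_iff_continuousAt.2 fun g₀ => ?_
    obtain ⟨t, ht, htg⟩ := exists_compact_mem_nhds g₀
    refine ContinuousOn.continuousAt ?_ htg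
    refine continuousOn_integral_of_compact_support (hs.isCompact.mul ht.inv) ?_ ?_
    · exact (hf.comp (continuous_snd.mul continuous_fst)).continuousOn
    · intro g x hg hx
      by_contra hne
      exact hx ⟨x * g, subset_tsupport _ hne, g⁻¹, by simpa using hg, by simp⟩
  rw [NNReal.isEmbedding_coe.continuous_iff]
  refine (hcont.div_const (∫ x, f x ∂μ)).congr fun g => ?_
  rw [integral_mul_right_eq_modularCharacter_mul, mul_div_assoc, div_self hpos.ne', mul_one]
  rfl

section Measure

variable [MeasurableSpace G] [BorelSpace G] (μ : Measure G) [μ.IsHaarMeasure] [μ.Regular]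

/-- The modular character is the density with respect to `μ` of the right Haar measure
`E ↦ μ E⁻¹`. This is the case `ν = μ.inv` of the formula expressing a left Haar measure through
a right Haar measure. -/
theorem integral_inv_mul_modularCharacter {f : G → ℝ} (hf : Continuous f)
    (hs : HasCompactSupport f) :
    ∫ x, f x⁻¹ * Measure.modularCharacter x ∂μ = ∫ x, f x ∂μ := by
  obtain ⟨⟨g, hg⟩, hgs, h0, h1⟩ :
    ∃ f : C(G, ℝ), HasCompactSupport f ∧ 0 ≤ f ∧ f 1 ≠ 0 := exists_continuous_nonneg_pos 1
  have hpos : 0 < ∫ x, g x ∂μ :=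
    hg.integral_pos_of_hasCompactSupport_nonneg_nonzero hgs h0 h1
  have hν : ∀ F : G → ℝ, ∫ x, F x ∂μ.inv = ∫ x, F x⁻¹ ∂μ :=
    fun F => (MeasurableEquiv.inv G).measurableEmbedding.integral_map F
  rw [Measure.integral_isMulLeftInvariant_isMulRightInvariant_combo (ν := μ.inv) hf hs hg hgs h0 h1]
  simp only [hν, inv_inv, integral_mul_right_eq_modularCharacter_mul, mul_inv, ← mul_assoc]
  rw [integral_mul_const, mul_assoc, inv_mul_cancel₀ hpos.ne', mul_one]
  simp

theorem integral_inv_mul_modularCharacter_complex {f : G → ℂ} (hf : Continuous f)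
    (hs : HasCompactSupport f) :
    ∫ x, f x⁻¹ * ((Measure.modularCharacter x : ℝ) : ℂ) ∂μ = ∫ x, f x ∂μ := by
  have hΔ : Continuous fun x : G => ((Measure.modularCharacter x : ℝ) : ℂ) :=
    Complex.continuous_ofReal.comp (NNReal.continuous_coe.comp continuous_modularCharacter)
  have hint : Integrable (fun x => f x⁻¹ * ((Measure.modularCharacter x : ℝ) : ℂ)) μ :=
    ((hf.comp continuous_inv).mul hΔ).integrable_of_hasCompactSupport
      (hs.comp_homeomorph (Homeomorph.inv G)).mul_right
  rw [← integral_re_add_im hint, ← integral_re_add_im (hf.integrable_of_hasCompactSupport hs)]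
  have hre := integral_inv_mul_modularCharacter μ (f := fun x => RCLike.re (f x))
    (RCLike.continuous_re.comp hf) (hs.comp_left (g := RCLike.re) (map_zero _))
  have him := integral_inv_mul_modularCharacter μ (f := fun x => RCLike.im (f x))
    (RCLike.continuous_im.comp hf) (hs.comp_left (g := RCLike.im) (map_zero _))
  rw [← hre, ← him]
  simp

/-- The involution `h ↦ h^♯`, `h^♯(s) = δ(s)⁻¹ (h (s⁻¹))^*`, for which `λ_h^* = λ_{h^♯}`. -/
def convStar (h : C_c(G, ℂ)) : C_c(G, ℂ) where
  toFun s := starRingEnd ℂ (h s⁻¹) * ((Measure.modularCharacter s : ℝ) : ℂ)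
  continuous_toFun := (RCLike.continuous_conj.comp (h.continuous.comp continuous_inv)).mul
    (Complex.continuous_ofReal.comp (NNReal.continuous_coe.comp continuous_modularCharacter))
  hasCompactSupport' := ((h.hasCompactSupport.comp_homeomorph (Homeomorph.inv G)).comp_left
    (g := starRingEnd ℂ) (map_zero _)).mul_right

theorem star_convOp (h : C_c(G, ℂ)) : star (convOp μ h) = convOp μ (convStar h) := by
  rw [ContinuousLinearMap.star_eq_adjoint]
  symm
  rw [ContinuousLinearMap.eq_adjoint_iff]
  intro x y
  rw [inner_convOp, ← inner_conj_symm, inner_convOp, ← integral_conj]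
  have hc : Continuous fun s => h s * inner ℂ x (lam μ s y) :=
    h.continuous.mul (continuous_const.inner (continuous_lam_apply μ y))
  rw [← integral_inv_mul_modularCharacter_complex μ hc h.hasCompactSupport.mul_right]
  refine integral_congr_ae (Eventually.of_forall fun s => ?_)
  simp only [convStar, map_mul, inner_conj_symm, inner_lam_right, inv_inv]
  change starRingEnd ℂ (starRingEnd ℂ (h s⁻¹) * ((Measure.modularCharacter s : ℝ) : ℂ)) * _ = _
  simp only [map_mul, RCLike.conj_conj, Complex.conj_ofReal]
  ring

theorem isSquareIntegrable_convOp [NormalSpace G] (h : C_c(G, ℂ)) :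
    IsSquareIntegrable μ (convOp μ h) :=
  ⟨_, isLeftConvolution_convOp μ h⟩

end Measure

section Power

theorem modularFn_pos (s : G) : 0 < modularFn s :=
  NNReal.coe_pos.2 (modularCharacter_pos _)

theorem modularFn_mul (s t : G) : modularFn (s * t) = modularFn s * modularFn t := by
  simp only [modularFn, mul_inv_rev, map_mul, NNReal.coe_mul]
  exact mul_comm _ _

/-- The continuous function `δ_G^a`. -/
def modularPow (a : ℝ) : C(G, ℂ) where
  toFun s := ((modularFn s ^ a : ℝ) : ℂ)
  continuous_toFun := by
    refine Complex.continuous_ofReal.comp (Continuous.rpow_const ?_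
      fun s => Or.inl (modularFn_pos s).ne')
    exact NNReal.continuous_coe.comp (continuous_modularCharacter.comp continuous_inv)

theorem modularPow_mul (a : ℝ) (s t : G) :
    modularPow a (s * t) = modularPow a s * modularPow a t := by
  change ((modularFn (s * t) ^ a : ℝ) : ℂ) =
    ((modularFn s ^ a : ℝ) : ℂ) * ((modularFn t ^ a : ℝ) : ℂ)
  rw [← Complex.ofReal_mul, ← Real.mul_rpow (modularFn_pos s).le (modularFn_pos t).le,
    modularFn_mul]

theorem modularPow_neg (a : ℝ) (s : G) : modularPow a s * modularPow (-a) s = 1 := by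
  change ((modularFn s ^ a : ℝ) : ℂ) * ((modularFn s ^ (-a) : ℝ) : ℂ) = 1
  rw [← Complex.ofReal_mul, ← Real.rpow_add (modularFn_pos s),
    add_neg_cancel, Real.rpow_zero, Complex.ofReal_one]

theorem pointwiseMul_modularPow_neg (a : ℝ) (h : C_c(G, ℂ)) :
    pointwiseMul (modularPow a) (pointwiseMul (modularPow (-a)) h) = h := by
  ext s
  change modularPow a s * (modularPow (-a) s * h s) = h s
  rw [← mul_assoc, modularPow_neg, one_mul]

end Power

section Measure

variable [MeasurableSpace G] [BorelSpace G] (μ : Measure G) [μ.IsHaarMeasure] [μ.Regular]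

omit [μ.Regular] in
/-- Powers of the modular function are characters, so that multiplication by them respects
convolution. -/
theorem modularPow_mul_convCc (a : ℝ) (h g : C_c(G, ℂ)) (x : G) :
    modularPow a x * convCc μ h g x =
      convCc μ (pointwiseMul (modularPow a) h) (pointwiseMul (modularPow a) g) x := by
  rw [convCc_apply, convCc_apply, ← integral_const_mul]
  refine integral_congr_ae (Eventually.of_forall fun s => ?_)
  change _ = modularPow a s * h s * (modularPow a (s⁻¹ * x) * g (s⁻¹ * x))
  have : modularPow a x = modularPow a s * modularPow a (s⁻¹ * x) := by
    rw [← modularPow_mul, mul_inv_cancel_left]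
  simp only [this]
  ring

/-- As `δ^{1/4}` is a character, `h * g` is `δ^{1/4}` times the convolution of `δ^{-1/4} h` and
`δ^{-1/4} g`. -/
theorem convOp_toL2_mem_H2 [LE G] [NormalSpace G] (h g : C_c(G, ℂ))
    (hh : convOp μ (pointwiseMul (modularPow (-(1 / 4))) h) ∈ hardyAlgebra μ)
    (hg : convOp μ (pointwiseMul (modularPow (-(1 / 4))) g) ∈ hardyAlgebra μ) :
    convOp μ h (toL2 μ g) ∈ H2 μ := by
  refine Submodule.le_topologicalClosure _ (Submodule.subset_span
    ⟨_, hh, _, hg, ?_, isSquareIntegrable_convOp μ _, _, isLeftConvolution_convOp_mul μ _ _, ?_⟩)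
  · rw [star_convOp]
    exact isSquareIntegrable_convOp μ _
  · rw [convOp_toL2]
    filter_upwards [coeFn_toL2 μ (convCc μ h g), coeFn_toL2 μ (convCc μ
      (pointwiseMul (modularPow (-(1 / 4))) h) (pointwiseMul (modularPow (-(1 / 4))) g))]
      with x h1 h2
    rw [h1, h2]
    change _ = modularPow (1 / 4) x * _
    rw [modularPow_mul_convCc, pointwiseMul_modularPow_neg, pointwiseMul_modularPow_neg]

/-! ### Right translations -/

theorem memLp_comp_mul_right (t : G) (x : L2 μ) : MemLp (fun y => x (y * t)) 2 μ := by
  have hm : μ.map (· * t) = Measure.modularCharacter t • μ :=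
    map_mul_right_eq_modularCharacter_smul μ t
  refine MemLp.comp_of_map (g := x) (f := (· * t)) ?_ (measurable_mul_const t).aemeasurable
  rw [hm]
  exact (Lp.memLp x).smul_measure ENNReal.coe_ne_top

theorem eLpNorm_comp_mul_right (t : G) (x : L2 μ) :
    eLpNorm (fun y => x (y * t)) 2 μ =
      (NNReal.sqrt (Measure.modularCharacter t) : ENNReal) * eLpNorm x 2 μ := by
  have h := (Homeomorph.mulRight t).measurableEmbedding.eLpNorm_map_measure (p := 2) (μ := μ)
    (g := x)
  simp only [Homeomorph.coe_mulRight] at h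
  rw [map_mul_right_eq_modularCharacter_smul, eLpNorm_smul_measure_of_ne_top' (by simp)] at h
  rw [NNReal.sqrt_eq_rpow]
  refine h.symm.trans ?_
  rw [ENNReal.smul_def]
  simp

theorem ae_comp_mul_right (t : G) {x y : G → ℂ} (h : x =ᵐ[μ] y) :
    (fun s => x (s * t)) =ᵐ[μ] fun s => y (s * t) := by
  refine Measure.QuasiMeasurePreserving.ae_eq_comp (f := (· * t)) (ν := μ)
    ⟨measurable_mul_const t, ?_⟩ h
  rw [map_mul_right_eq_modularCharacter_smul]
  exact Measure.smul_absolutelyContinuous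

/-- The right regular representation `(ρ_t x)(s) = δ_G(t)^{-1/2} x(s t⁻¹)`, which takes functions
supported in `K` to functions supported in `K t`. -/
def rightTrans (t : G) : L2 μ →ₗᵢ[ℂ] L2 μ where
  toFun x := ((NNReal.sqrt (Measure.modularCharacter t) : ℝ) : ℂ) •
    (memLp_comp_mul_right μ t⁻¹ x).toLp _
  map_add' x y := by
    rw [← smul_add, ← MemLp.toLp_add]
    congr 1
    exact MemLp.toLp_congr _ _ (ae_comp_mul_right μ t⁻¹ (Lp.coeFn_add x y))
  map_smul' c x := by
    rw [RingHom.id_apply, smul_comm c]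
    exact congrArg _ ((MemLp.toLp_congr _ ((memLp_comp_mul_right μ t⁻¹ x).const_smul c)
      (ae_comp_mul_right μ t⁻¹ (Lp.coeFn_smul c x))).trans (MemLp.toLp_const_smul _ _))
  norm_map' x := by
    change ‖((NNReal.sqrt (Measure.modularCharacter t) : ℝ) : ℂ) •
      (memLp_comp_mul_right μ t⁻¹ x).toLp _‖ = _
    rw [norm_smul, Lp.norm_toLp, eLpNorm_comp_mul_right, ENNReal.toReal_mul, ← Lp.norm_def,
      Complex.norm_real, NNReal.norm_eq, ENNReal.coe_toReal, ← mul_assoc, ← NNReal.coe_mul,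
      ← NNReal.sqrt_mul, ← map_mul, mul_inv_cancel, map_one, NNReal.sqrt_one, NNReal.coe_one,
      one_mul]

theorem coeFn_rightTrans (t : G) (x : L2 μ) :
    rightTrans μ t x =ᵐ[μ] fun s =>
      ((NNReal.sqrt (Measure.modularCharacter t) : ℝ) : ℂ) * x (s * t⁻¹) := by
  filter_upwards [Lp.coeFn_smul ((NNReal.sqrt (Measure.modularCharacter t) : ℝ) : ℂ)
    ((memLp_comp_mul_right μ t⁻¹ x).toLp _), (memLp_comp_mul_right μ t⁻¹ x).coeFn_toLp]
    with s h1 h2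
  refine h1.trans ?_
  rw [Pi.smul_apply, h2, smul_eq_mul]

theorem rightTrans_toL2 (t : G) (k : C_c(G, ℂ)) :
    rightTrans μ t (toL2 μ k) =
      ((NNReal.sqrt (Measure.modularCharacter t) : ℝ) : ℂ) • toL2 μ (rightTranslate t k) := by
  rw [← toL2_smul]
  refine eq_toL2_of_ae μ ?_
  filter_upwards [coeFn_rightTrans μ t (toL2 μ k), ae_comp_mul_right μ t⁻¹ (coeFn_toL2 μ k)]
    with s h1 h2
  rw [h1, h2]
  rfl

theorem rightTrans_lam (t s : G) (x : L2 μ) :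
    rightTrans μ t (lam μ s x) = lam μ s (rightTrans μ t x) := by
  refine Lp.ext ?_
  have h := (measurePreserving_mul_left μ s⁻¹).quasiMeasurePreserving.ae_eq_comp
    (coeFn_rightTrans μ t x)
  filter_upwards [coeFn_rightTrans μ t (lam μ s x), ae_comp_mul_right μ t⁻¹ (coeFn_lam μ s x),
    coeFn_lam μ s (rightTrans μ t x), h] with y h1 h2 h3 h4
  rw [h1, h2, h3]
  simp only [Function.comp_apply] at h4
  rw [h4, mul_assoc]

theorem rightTrans_convOp (t : G) (h : C_c(G, ℂ)) (x : L2 μ) :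
    rightTrans μ t (convOp μ h x) = convOp μ h (rightTrans μ t x) := by
  rw [convOp_apply, convOp_apply]
  refine ((rightTrans μ t).toContinuousLinearMap.integral_comp_comm
    (integrable_smul_lam μ h x)).symm.trans ?_
  refine integral_congr_ae (Eventually.of_forall fun s => ?_)
  simp [rightTrans_lam]

/-- The right translations are in the commutant of `VN(G)`. -/
theorem commute_rightTrans (f : VN μ) (t : G) (x : L2 μ) :
    (f : L2 μ →L[ℂ] L2 μ) (rightTrans μ t x) = rightTrans μ t ((f : L2 μ →L[ℂ] L2 μ) x) := by
  have hf : (f : L2 μ →L[ℂ] L2 μ) ∈ StarSubalgebra.centralizer ℂ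
    (StarSubalgebra.centralizer ℂ (Set.range (lam μ)) : Set (L2 μ →L[ℂ] L2 μ)) := f.2
  have hR : (rightTrans μ t).toContinuousLinearMap ∈
      StarSubalgebra.centralizer ℂ (Set.range (lam μ)) := by
    rw [StarSubalgebra.mem_centralizer_iff]
    have key : ∀ s, lam μ s * (rightTrans μ t).toContinuousLinearMap =
        (rightTrans μ t).toContinuousLinearMap * lam μ s := fun s => by
      ext1 x
      exact (rightTrans_lam μ t s x).symm
    rintro _ ⟨s, rfl⟩
    exact ⟨key s, by rw [star_lam]; exact key s⁻¹⟩
  have := ((StarSubalgebra.mem_centralizer_iff ℂ).1 hf _ hR).1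
  exact (congrArg (fun T : L2 μ →L[ℂ] L2 μ => T x) this).symm

end Measure
end Modular

/-! ### Convolution operators in the Hardy algebra -/

section SigmaWeak

section Functional

variable {H : Type*} [NormedAddCommGroup H] [InnerProductSpace ℂ H]

omit [InnerProductSpace ℂ H] in
theorem summable_norm_mul_norm_lp (p : lp (fun _ : ℕ => H) 2 × lp (fun _ : ℕ => H) 2) :
    Summable fun n => ‖p.1 n‖ * ‖p.2 n‖ :=
  lp.summable_mul (p := 2) (q := 2) (by norm_num [Real.holderConjugate_iff]) p.1 p.2

theorem summable_sigmaWeak (p : lp (fun _ : ℕ => H) 2 × lp (fun _ : ℕ => H) 2) (x : H →L[ℂ] H) :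
    Summable fun n => inner ℂ (p.1 n) (x (p.2 n)) := by
  refine Summable.of_norm_bounded ((summable_norm_mul_norm_lp p).mul_left ‖x‖) fun n => ?_
  calc _ ≤ ‖p.1 n‖ * ‖x (p.2 n)‖ := norm_inner_le_norm _ _
    _ ≤ ‖p.1 n‖ * (‖x‖ * ‖p.2 n‖) := by gcongr; exact x.le_opNorm _
    _ = _ := by ring

/-- The functional `x ↦ ∑ₙ ⟪ξₙ, x ηₙ⟫` on the bounded operators. -/
def sigmaWeakFunctional (p : lp (fun _ : ℕ => H) 2 × lp (fun _ : ℕ => H) 2) :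
    (H →L[ℂ] H) →ₗ[ℂ] ℂ where
  toFun x := ∑' n : ℕ, inner ℂ (p.1 n) (x (p.2 n))
  map_add' x y := by
    simp only [add_apply, inner_add_right]
    exact (summable_sigmaWeak p x).tsum_add (summable_sigmaWeak p y)
  map_smul' c x := by
    simp only [smul_apply, inner_smul_right, RingHom.id_apply, smul_eq_mul]
    exact tsum_mul_left

/-- In order to be in the `σ`-weak closure of a subspace it suffices to agree on any finitely many
`σ`-weakly continuous functionals with an element of the subspace; in finite dimension, this
amounts to being annihilated by their linear combinations that vanish on the subspace. -/
theorem mem_sigmaWeak_closure_of_forall (V : Submodule ℂ (H →L[ℂ] H)) (a : H →L[ℂ] H)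
    (h : ∀ (I : Finset (lp (fun _ : ℕ => H) 2 × lp (fun _ : ℕ => H) 2)) (c : I → ℂ),
      (∀ x ∈ V, ∑ i, sigmaWeakFunctional i.1 x * c i = 0) →
        ∑ i, sigmaWeakFunctional i.1 a * c i = 0) :
    a ∈ @closure _ (sigmaWeakTopology H) (V : Set (H →L[ℂ] H)) := by
  classical
  unfold sigmaWeakTopology
  rw [closure_induced, mem_closure_iff_nhds]
  intro t ht
  rw [nhds_pi, Filter.mem_pi] at ht
  obtain ⟨I, hI, u, hu, hut⟩ := ht
  obtain ⟨I, rfl⟩ := hI.exists_finset_coe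
  let F : (H →L[ℂ] H) →ₗ[ℂ] (I → ℂ) := LinearMap.pi fun i => sigmaWeakFunctional i.1
  have hmem : F a ∈ V.map F := by
    by_contra hn
    obtain ⟨l, hl, hlV⟩ := Submodule.exists_le_ker_of_notMem hn
    refine hl ?_
    have hsum : ∀ x, l (F x) =
        ∑ i, sigmaWeakFunctional i.1 x * l (fun j => if i = j then 1 else 0) :=
      fun x => l.pi_apply_eq_sum_univ (F x)
    rw [hsum]
    refine h I _ fun x hx => ?_
    rw [← hsum]
    exact hlV (Submodule.mem_map_of_mem hx)
  obtain ⟨y, hy, hya⟩ := hmem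
  refine ⟨_, hut fun p hp => ?_, ⟨y, hy, rfl⟩⟩
  have : sigmaWeakFunctional p y = sigmaWeakFunctional p a := congrFun hya ⟨p, hp⟩
  change sigmaWeakFunctional p y ∈ u p
  rw [this]
  exact mem_of_mem_nhds (hu p)

end Functional

variable {G : Type*} [Group G] [TopologicalSpace G] [IsTopologicalGroup G]
  [MeasurableSpace G] [BorelSpace G] [LocallyCompactSpace G]
  (μ : Measure G) [μ.IsHaarMeasure] [μ.Regular]

theorem continuous_sigmaWeakFunctional_lam
    (p : lp (fun _ : ℕ => L2 μ) 2 × lp (fun _ : ℕ => L2 μ) 2) :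
    Continuous fun s => sigmaWeakFunctional p (lam μ s) :=
  continuous_tsum (fun _ => continuous_const.inner (continuous_lam_apply μ _))
    (summable_norm_mul_norm_lp p) fun n s =>
      (norm_inner_le_norm _ _).trans_eq (by rw [norm_lam_apply])

theorem sigmaWeakFunctional_convOp (h : C_c(G, ℂ))
    (p : lp (fun _ : ℕ => L2 μ) 2 × lp (fun _ : ℕ => L2 μ) 2) :
    sigmaWeakFunctional p (convOp μ h) = ∫ s, h s * sigmaWeakFunctional p (lam μ s) ∂μ := by
  change ∑' n, inner ℂ (p.1 n) (convOp μ h (p.2 n)) =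
    ∫ s, h s * ∑' n, inner ℂ (p.1 n) (lam μ s (p.2 n)) ∂μ
  simp_rw [inner_convOp, ← tsum_mul_left]
  refine integral_tsum_of_summable_integral_norm (fun n => ?_) ?_
  · exact (h.continuous.mul (continuous_const.inner
      (continuous_lam_apply μ _))).integrable_of_hasCompactSupport h.hasCompactSupport.mul_right
  · refine Summable.of_nonneg_of_le (fun n => integral_nonneg fun s => norm_nonneg _) (fun n => ?_)
      ((summable_norm_mul_norm_lp p).mul_left (∫ s, ‖h s‖ ∂μ))
    rw [← integral_mul_const]
    have hc : Continuous fun s => h s * inner ℂ (p.1 n) (lam μ s (p.2 n)) :=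
      h.continuous.mul (continuous_const.inner (continuous_lam_apply μ _))
    refine integral_mono (hc.norm.integrable_of_hasCompactSupport
      h.hasCompactSupport.mul_right.norm)
      ((h.continuous.norm.integrable_of_hasCompactSupport h.hasCompactSupport.norm).mul_const _)
      fun s => ?_
    simp only [norm_mul]
    gcongr
    exact (norm_inner_le_norm _ _).trans_eq (by rw [norm_lam_apply])

/-- `λ_h = ∫ h(s) λ_s ds` is a `σ`-weakly convergent integral of elements `λ_s` with `s ≥ 1`. -/
theorem convOp_mem_hardyAlgebra [LE G] (h : C_c(G, ℂ)) (hh : ∀ s, h s ≠ 0 → 1 ≤ s) :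
    convOp μ h ∈ hardyAlgebra μ := by
  refine mem_sigmaWeak_closure_of_forall _ _ fun I c hc => ?_
  simp_rw [sigmaWeakFunctional_convOp, ← integral_mul_const]
  rw [← integral_finsetSum]
  · refine integral_eq_zero_of_ae (Eventually.of_forall fun s => ?_)
    by_cases hs : h s = 0
    · simp [hs]
    · have := hc (lam μ s) (Submodule.subset_span ⟨s, hh s hs, rfl⟩)
      simp only [mul_assoc, ← Finset.mul_sum, this, mul_zero, Pi.zero_apply]
  · intro i _
    exact ((h.continuous.mul (continuous_sigmaWeakFunctional_lam μ
      i.1)).integrable_of_hasCompactSupport h.hasCompactSupport.mul_right).mul_const _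

/-- The Hardy space contains all convolutions `h * g` of functions in `C_c(G)` that are supported
in `{s | 1 ≤ s}`. -/
theorem convOp_toL2_mem_H2_of_one_le [LE G] [NormalSpace G] (h g : C_c(G, ℂ))
    (hh : ∀ s, h s ≠ 0 → 1 ≤ s) (hg : ∀ s, g s ≠ 0 → 1 ≤ s) :
    convOp μ h (toL2 μ g) ∈ H2 μ :=
  convOp_toL2_mem_H2 μ h g
    (convOp_mem_hardyAlgebra μ _ fun s hs => hh s (right_ne_zero_of_mul hs))
    (convOp_mem_hardyAlgebra μ _ fun s hs => hg s (right_ne_zero_of_mul hs))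

end SigmaWeak

/-! ### Translation into the Hardy space -/

section Ordered

section Order

variable {G : Type*} [Group G] [LinearOrder G] [MulLeftMono G]

/-- Only left translations are assumed to be monotone, so that the corresponding fact on ordered
groups does not apply. -/
theorem noMaxOrder_of_nontrivial [Nontrivial G] : NoMaxOrder G := by
  obtain ⟨u, hu⟩ : ∃ u : G, 1 < u := by
    obtain ⟨u, hu⟩ := exists_ne (1 : G)
    rcases lt_or_gt_of_ne hu with h | h
    · refine ⟨u⁻¹, lt_of_le_of_ne ?_ fun e => hu (inv_eq_one.1 e.symm)⟩
      simpa using mul_le_mul_right h.le u⁻¹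
    · exact ⟨u, h⟩
  refine ⟨fun a => ⟨a * u, lt_of_le_of_ne ?_ fun e => hu.ne' ?_⟩⟩
  · simpa using mul_le_mul_right hu.le a
  · simpa using e.symm

variable [TopologicalSpace G] [OrderTopology G] [IsTopologicalGroup G]

/-- Since left translations preserve the order, right translates of a compact set eventually
consist of elements `≥ 1`: `1 ≤ x t` as soon as `x⁻¹ ≤ t`. -/
theorem eventually_one_le_of_rightTranslate_ne_zero [Nontrivial G] (k : C_c(G, ℂ)) :
    ∀ᶠ t in atTop, ∀ x, rightTranslate t k x ≠ 0 → 1 ≤ x := by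
  obtain ⟨M, hM⟩ := k.hasCompactSupport.isCompact.inv.bddAbove
  filter_upwards [eventually_ge_atTop M] with t ht x hx
  have hmem : x * t⁻¹ ∈ tsupport k := subset_tsupport _ hx
  have h := (hM (show (x * t⁻¹)⁻¹ ∈ (tsupport k)⁻¹ by simpa using hmem)).trans ht
  simpa using mul_le_mul_right h (x * t⁻¹)

end Order

variable {G : Type*} [Group G] [TopologicalSpace G] [IsTopologicalGroup G]
  [LocallyCompactSpace G] [Nontrivial G] [LinearOrder G] [MulLeftMono G] [OrderTopology G]
  [MeasurableSpace G] [BorelSpace G] (μ : Measure G) [μ.IsHaarMeasure] [μ.Regular]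

theorem eventually_inner_rightTrans_toL2 (u k : C_c(G, ℂ)) :
    ∀ᶠ t in atTop, inner ℂ (toL2 μ u) (rightTrans μ t (toL2 μ k)) = 0 := by
  have := noMaxOrder_of_nontrivial (G := G)
  have hcpt : IsCompact ((tsupport k)⁻¹ * tsupport u) :=
    k.hasCompactSupport.isCompact.inv.mul u.hasCompactSupport.isCompact
  filter_upwards [atTop_le_cocompact hcpt.compl_mem_cocompact] with t ht
  rw [rightTrans_toL2, inner_smul_right, inner_toL2]
  refine mul_eq_zero_of_right _ (integral_eq_zero_of_ae (Eventually.of_forall fun x => ?_))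
  by_contra hne
  have hne' := mul_ne_zero_iff.1 hne
  refine ht ⟨(x * t⁻¹)⁻¹, ?_, x, subset_tsupport _ fun h0 => hne'.2 (by simp [h0]), by simp⟩
  rw [Set.mem_inv, inv_inv]
  exact subset_tsupport _ hne'.1

/-- The right translations tend weakly to zero. -/
theorem tendsto_inner_rightTrans (x u : L2 μ) :
    Tendsto (fun t => inner ℂ u (rightTrans μ t x)) atTop (𝓝 0) := by
  rw [Metric.tendsto_nhds]
  intro ε hε
  obtain ⟨k, hk⟩ := (denseRange_toL2 μ).exists_dist_lt x
    (show 0 < ε / (2 * (‖u‖ + 1)) by positivity)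
  obtain ⟨w, hw⟩ := (denseRange_toL2 μ).exists_dist_lt u
    (show 0 < ε / (2 * (‖toL2 μ k‖ + 1)) by positivity)
  rw [dist_eq_norm, lt_div_iff₀ (by positivity)] at hk hw
  filter_upwards [eventually_inner_rightTrans_toL2 μ w k] with t ht
  -- the remaining term `⟪w, ρ_t k⟫` vanishes
  have hsplit : inner ℂ u (rightTrans μ t x) = inner ℂ u (rightTrans μ t (x - toL2 μ k)) +
      inner ℂ (u - toL2 μ w) (rightTrans μ t (toL2 μ k)) := by
    rw [map_sub, inner_sub_right, inner_sub_left, ht]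
    ring
  rw [dist_zero_right, hsplit]
  have h1 := norm_inner_le_norm (𝕜 := ℂ) u (rightTrans μ t (x - toL2 μ k))
  have h2 := norm_inner_le_norm (𝕜 := ℂ) (u - toL2 μ w) (rightTrans μ t (toL2 μ k))
  rw [LinearIsometry.norm_map] at h1 h2
  have h3 := norm_add_le (inner ℂ u (rightTrans μ t (x - toL2 μ k)))
    (inner ℂ (u - toL2 μ w) (rightTrans μ t (toL2 μ k)))
  nlinarith [norm_nonneg (x - toL2 μ k), norm_nonneg (u - toL2 μ w)]

/-- The vectors whose right translates are eventually in the Hardy space. -/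
def eventuallyHardy : Submodule ℂ (L2 μ) where
  carrier := {x | ∀ᶠ t in atTop, rightTrans μ t x ∈ H2 μ}
  zero_mem' := Eventually.of_forall fun t => by rw [map_zero]; exact zero_mem _
  add_mem' hx hy := by
    filter_upwards [hx, hy] with t h1 h2
    rw [map_add]
    exact add_mem h1 h2
  smul_mem' c x hx := by
    filter_upwards [hx] with t h
    rw [map_smul]
    exact Submodule.smul_mem _ c h

theorem convOp_toL2_mem_eventuallyHardy (h k : C_c(G, ℂ)) (hh : ∀ s, h s ≠ 0 → 1 ≤ s) :
    convOp μ h (toL2 μ k) ∈ eventuallyHardy μ := by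
  filter_upwards [eventually_one_le_of_rightTranslate_ne_zero k] with t ht
  rw [rightTrans_convOp, rightTrans_toL2, map_smul]
  exact Submodule.smul_mem _ _ (convOp_toL2_mem_H2_of_one_le μ _ _ hh ht)

omit [Nontrivial G] [LinearOrder G] [MulLeftMono G] [OrderTopology G] in
/-- `λ_h λ_u x` is the average of `λ_{su} x` with respect to the density `h = f`. -/
theorem norm_convOp_lam_sub_le (h : C_c(G, ℂ)) (f : G → ℝ) (hf : ∀ s, h s = f s) (h0 : 0 ≤ f)
    (h1 : ∫ s, f s ∂μ = 1) (u : G) (x : L2 μ) (ε : ℝ)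
    (hε : ∀ s, f s ≠ 0 → ‖lam μ (s * u) x - x‖ ≤ ε) :
    ‖convOp μ h (lam μ u x) - x‖ ≤ ε := by
  have hi : Integrable h μ := h.continuous.integrable_of_hasCompactSupport h.hasCompactSupport
  have hfi : Integrable f μ := by
    have := hi.norm
    simpa only [hf, Complex.norm_real, Real.norm_of_nonneg (h0 _)] using this
  have hh1 : ∫ s, h s ∂μ = 1 := by
    simp only [hf]
    rw [integral_complex_ofReal, h1, Complex.ofReal_one]
  have hx : convOp μ h (lam μ u x) - x = ∫ s, h s • (lam μ (s * u) x - x) ∂μ := by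
    have hx1 : ∫ s, h s • x ∂μ = x := by rw [integral_smul_const, hh1, one_smul]
    simp only [smul_sub, ← lam_lam]
    rw [integral_sub (integrable_smul_lam μ h _) (hi.smul_const x), hx1, convOp_apply]
  rw [hx]
  calc _ ≤ ∫ s, f s * ε ∂μ := by
        refine norm_integral_le_of_norm_le (hfi.mul_const ε) (Eventually.of_forall fun s => ?_)
        rw [norm_smul, hf, Complex.norm_real, Real.norm_of_nonneg (h0 s)]
        by_cases hs : f s = 0
        · simp [hs]
        · exact mul_le_mul_of_nonneg_left (hε s hs) (h0 s)
    _ = ε := by rw [integral_mul_const, h1, one_mul]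

omit [Nontrivial G] [LinearOrder G] [MulLeftMono G] [OrderTopology G] [μ.Regular] in
theorem exists_normalized_bump {V : Set G} (hV : IsOpen V) {u : G} (hu : u ∈ V) :
    ∃ (h : C_c(G, ℂ)) (f : G → ℝ), (∀ s, h s = f s) ∧ 0 ≤ f ∧ ∫ s, f s ∂μ = 1 ∧
      ∀ s, f s ≠ 0 → s ∈ V := by
  obtain ⟨f, hf1, hfc, hfV, hf01⟩ := exists_continuousMap_one_of_isCompact_subset_isOpen
    (isCompact_singleton (x := u)) hV (Set.singleton_subset_iff.2 hu)
  have hpos : 0 < ∫ s, f s ∂μ := f.continuous.integral_pos_of_hasCompactSupport_nonneg_nonzero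
    (x := u) hfc (fun s => (hf01 s).1) (by rw [hf1 rfl]; exact one_ne_zero)
  refine ⟨⟨⟨fun s => ((f s / ∫ s, f s ∂μ : ℝ) : ℂ), by fun_prop⟩, ?_⟩,
    fun s => f s / ∫ s, f s ∂μ, fun s => rfl, fun s => div_nonneg (hf01 s).1 hpos.le, ?_, ?_⟩
  · exact HasCompactSupport.comp_left (f := f) (g := fun r : ℝ => ((r / ∫ s, f s ∂μ : ℝ) : ℂ))
      hfc (by simp)
  · rw [integral_div, div_self hpos.ne']
  · exact fun s hs => hfV (subset_tsupport _ (div_ne_zero_iff.1 hs).1)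

/-- An approximate identity must be supported in `{s | 1 ≤ s}` here. Instead of one concentrated
near the identity, the proof uses densities `h` concentrated near some `u > 1`, where this is no
restriction, and approximates `k` by `λ_h λ_{u⁻¹} k`. This also covers discrete groups. -/
theorem toL2_mem_closure_eventuallyHardy (k : C_c(G, ℂ)) :
    toL2 μ k ∈ (eventuallyHardy μ).topologicalClosure := by
  have := noMaxOrder_of_nontrivial (G := G)
  change _ ∈ closure _
  rw [Metric.mem_closure_iff]
  intro ε hε
  obtain ⟨u, hu⟩ := exists_gt (1 : G)
  have hopen : IsOpen ({s : G | ‖lam μ (s * u⁻¹) (toL2 μ k) - toL2 μ k‖ < ε / 2} ∩ Set.Ioi 1) :=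
    (isOpen_lt ((((continuous_lam_apply μ (toL2 μ k)).comp (continuous_mul_const u⁻¹)).sub
      continuous_const).norm) continuous_const).inter isOpen_Ioi
  have humem : u ∈ {s : G | ‖lam μ (s * u⁻¹) (toL2 μ k) - toL2 μ k‖ < ε / 2} ∩ Set.Ioi 1 :=
    ⟨by simp [lam_one, hε], hu⟩
  obtain ⟨h, f, hf, h0, h1, hV⟩ := exists_normalized_bump μ hopen humem
  refine ⟨convOp μ h (lam μ u⁻¹ (toL2 μ k)), ?_, ?_⟩
  · rw [lam_toL2]
    refine convOp_toL2_mem_eventuallyHardy μ h _ fun s hs => (hV s fun hfs => hs ?_).2.le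
    rw [hf, hfs, Complex.ofReal_zero]
  · rw [dist_comm, dist_eq_norm]
    exact (norm_convOp_lam_sub_le μ h f hf h0 h1 u⁻¹ _ (ε / 2)
      fun s hs => (hV s hs).1.le).trans_lt (half_lt_self hε)

theorem dense_eventuallyHardy : Dense (eventuallyHardy μ : Set (L2 μ)) := by
  refine dense_closure.1 ((denseRange_toL2 μ).mono ?_)
  rintro _ ⟨k, rfl⟩
  exact toL2_mem_closure_eventuallyHardy μ k

/-- Right translations move every vector asymptotically into the Hardy space. -/
theorem tendsto_rightTrans_sub_starProjection (x : L2 μ) :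
    Tendsto (fun t => rightTrans μ t x - (H2 μ).starProjection (rightTrans μ t x))
      atTop (𝓝 0) := by
  rw [Metric.tendsto_nhds]
  intro ε hε
  obtain ⟨y, hxy, hy⟩ := Metric.dense_iff.1 (dense_eventuallyHardy μ) x ε hε
  have hy' : ∀ᶠ t in atTop, rightTrans μ t y ∈ H2 μ := hy
  filter_upwards [hy'] with t ht
  rw [dist_zero_right]
  refine (norm_sub_starProjection_le _ _ ht).trans_lt ?_
  rwa [← map_sub, LinearIsometry.norm_map, ← dist_eq_norm, dist_comm]

omit [Nontrivial G] [MulLeftMono G] [OrderTopology G] [μ.Regular] in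
theorem inner_toeplitz (f : L2 μ →L[ℂ] L2 μ) (x y : H2 μ) :
    inner ℂ (toeplitz μ f x) y = inner ℂ x (toeplitz μ (star f) y) := by
  change inner ℂ ((H2 μ).orthogonalProjectionOnto (f x)) y =
    inner ℂ x ((H2 μ).orthogonalProjectionOnto (star f y))
  rw [Submodule.inner_orthogonalProjectionOnto_eq_of_mem_left,
    Submodule.inner_orthogonalProjectionOnto_eq_of_mem_right,
    ContinuousLinearMap.star_eq_adjoint, ContinuousLinearMap.adjoint_inner_right]

theorem isBoundedBelow_of_toeplitz_estimate (f : VN μ) (K : Submodule ℂ (H2 μ))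
    [FiniteDimensional ℂ K] (C : ℝ) (hC : 0 < C)
    (hK : ∀ x, ‖x - K.starProjection x‖ ≤ C * ‖toeplitz μ (f : L2 μ →L[ℂ] L2 μ) x‖) :
    IsBoundedBelow (f : L2 μ →L[ℂ] L2 μ) :=
  isBoundedBelow_of_compression_estimate (H2 μ) f atTop (rightTrans μ) (commute_rightTrans μ f)
    (tendsto_rightTrans_sub_starProjection μ) (tendsto_inner_rightTrans μ) K C hC hK

end Ordered

end

end GroupHardy

theorem theorem14 {G : Type*} [Group G] [TopologicalSpace G] [IsTopologicalGroup G]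
    [LocallyCompactSpace G] [Nontrivial G] [LinearOrder G] [MulLeftMono G] [OrderTopology G]
    [MeasurableSpace G] [BorelSpace G] (μ : MeasureTheory.Measure G) [μ.IsHaarMeasure] [μ.Regular]
    (f : GroupHardy.VN μ) :
    (GroupHardy.IsUpperSemiFredholm
        (GroupHardy.toeplitz μ (f : GroupHardy.L2 μ →L[ℂ] GroupHardy.L2 μ)) →
      GroupHardy.IsBoundedBelow (f : GroupHardy.L2 μ →L[ℂ] GroupHardy.L2 μ)) ∧
    (GroupHardy.IsFredholm
        (GroupHardy.toeplitz μ (f : GroupHardy.L2 μ →L[ℂ] GroupHardy.L2 μ)) →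
      IsUnit f) := by
  have hupper : GroupHardy.IsUpperSemiFredholm
      (GroupHardy.toeplitz μ (f : GroupHardy.L2 μ →L[ℂ] GroupHardy.L2 μ)) →
      GroupHardy.IsBoundedBelow (f : GroupHardy.L2 μ →L[ℂ] GroupHardy.L2 μ) := fun h => by
    obtain ⟨K, _, C, hC, hK⟩ := h.exists_norm_sub_le
    exact GroupHardy.isBoundedBelow_of_toeplitz_estimate μ f K C hC hK
  refine ⟨hupper, fun h => GroupHardy.isUnit_vonNeumannAlgebra _ _ ((hupper h.1).isUnit _ ?_)⟩
  obtain ⟨K, _, C, hC, hK⟩ := h.2.exists_norm_sub_le_adjoint _ _ (GroupHardy.inner_toeplitz μ _)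
  exact GroupHardy.isBoundedBelow_of_toeplitz_estimate μ (star f) K C hC hK
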